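/- **Theorem 4.1.** Let $\psi\colon\mathbb R\to[0,\infty]$ be a convex function with closed epigraph and $\psi(0)=0$, whose effective domain $\operatorname{dom}(\psi)=\{\lambda\in\mathbb R\colon\psi(\lambda)<\infty\}$ is either $[0,\lambda_{\max})$ for some $\lambda_{\max}\in(0,\infty]$ or $[0,\lambda_{\max}]$ for some $\lambda_{\max}\in(0,\infty)$. Let $\psi^*(x)=\sup_{\lambda\in\mathbb R}\{\lambda x-\psi(\lambda)\}$ be its convex conjugate, and let $\mathcal X=\operatorname{dom}(\psi^*)=\{x\in\mathbb R\colon\psi^*(x)<\infty\}$ with its Borel $\sigma$-algebra. Let $\mathcal P$ be the set of probability measures $\mu$ on $\mathcal X$ that are sub-$\psi$, i.e. $\int e^{\lambda x}\,\mu(dx)\le e^{\psi(\lambda)}$ for all $\lambda\in\operatorname{dom}(\psi)$. Let $\Lambda=[0,\lambda_{\max}]\subset[0,\infty]$ and, for $x\in\mathcal X$ and $\lambda\in\Lambda$, set $g_\lambda(x)=e^{\lambda x-\psi(\lambda)}-1$, where, if $\lambda_{\max}\notin\operatorname{dom}(\psi)$, the value of $e^{\lambda x-\psi(\lambda)}$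 at $\lambda=\lambda_{\max}$ is understood as the limit as $\lambda\uparrow\lambda_{\max}$. Let $\Phi=\{g_\lambda\colon\lambda\in\Lambda\}$. Then $\mathcal P$ is the hypothesis generated by $\Phi$, that is, the set of all probability measures $\mu$ on $\mathcal X$ such that $\int|g|\,d\mu<\infty$ and $\int g\,d\mu\le0$ for all $g\in\Phi$. Let $\mathcal L^\Phi$ be the set of measurable functions $f\colon\mathcal X\to\mathbb R$ with $\int|f|\,d\mu<\infty$ for all $\mu$ in this hypothesis. The following hold. 1. A function $f\in\mathcal L^\Phi$ satisfies $\int f\,d\mu\le0$ for all $\mu\in\mathcal P$ if and only if there is a finite (nonnegative) Borel measure $\pi$ on $\Lambda$ such that $$f(x)\le\int_\Lambda g_\lambda(x)\,\pi(d\lambda)\quad\text{for all }x\in\mathcal X.$$ 2. The e-variables for $\mathcal P$, i.e. the measurable functions $h\colon\mathcal X\to[0,\infty]$ with $\int h\,d\mu\le1$ for all $\mu\in\mathcal P$, are exactly the measurable functions $h\colon\mathcal X\to[0,\infty]$ for which there is a Borel probability measure $\pi$ on $\Lambda$ such that $$h(x)\le\int_\Lambda e^{\lambda x-\psi(\lambda)}\,\pi(d\lambda)\quad\text{for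 all }x\in\mathcal X.$$ -/

import Mathlib

open MeasureTheory Set Filter Topology
open scoped ENNReal

noncomputable section

namespace EVar

section General

variable {X : Type*} [MeasurableSpace X]

/-- The hypothesis generated by a set `Φ` of constraint functions: all probability measures that
integrate every member of `Φ`, with nonpositive integral. -/
def generatedHypothesis (Φ : Set (X → ℝ)) : Set (Measure X) :=
  {μ | IsProbabilityMeasure μ ∧ ∀ f ∈ Φ, Integrable f μ ∧ ∫ x, f x ∂μ ≤ 0}

/-- The space `𝓛^Φ` of real-valued measurable functions that are integrable under every measure
in the hypothesis generated by `Φ`. -/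
def integrableFunctions (Φ : Set (X → ℝ)) : Set (X → ℝ) :=
  {f | Measurable f ∧ ∀ μ ∈ generatedHypothesis Φ, Integrable f μ}

/-- The e-variables for a family `P` of measures: `[0, ∞]`-valued measurable functions whose
expected value under every member of `P` is at most one. -/
def eVariables (P : Set (Measure X)) : Set (X → ℝ≥0∞) :=
  {h | Measurable h ∧ ∀ μ ∈ P, ∫⁻ x, h x ∂μ ≤ 1}

end General

/-- The effective domain of an extended real-valued function on `ℝ`. -/
def effDom (ψ : ℝ → EReal) : Set ℝ := {l | ψ l < ⊤}

/-- The standing assumptions on `ψ : ℝ → ℝ ∪ {∞}`: it is nonnegative (so never `-∞`), vanishes at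
`0`, is convex and closed (its epigraph is convex and closed), and its effective domain is
`[0, lmax)` with `lmax ∈ (0, ∞]` or `[0, lmax]` with `lmax ∈ (0, ∞)`. -/
structure IsAdmissible (ψ : ℝ → EReal) (lmax : EReal) : Prop where
  nonneg : ∀ l, 0 ≤ ψ l
  map_zero : ψ 0 = 0
  convex_epigraph : Convex ℝ {p : ℝ × ℝ | ψ p.1 ≤ (p.2 : EReal)}
  closed_epigraph : IsClosed {p : ℝ × ℝ | ψ p.1 ≤ (p.2 : EReal)}
  lmax_pos : 0 < lmax
  effDom_eq : effDom ψ = {l : ℝ | 0 ≤ l ∧ (l : EReal) < lmax} ∨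
    (lmax < ⊤ ∧ effDom ψ = {l : ℝ | 0 ≤ l ∧ (l : EReal) ≤ lmax})

/-- The convex conjugate `ψ^*(x) = sup_l (l x - ψ l)`. -/
def conjugate (ψ : ℝ → EReal) (x : ℝ) : EReal := ⨆ l : ℝ, (((l * x : ℝ) : EReal) - ψ l)

/-- The sample space: the effective domain of `ψ^*`, as a measurable subspace of `ℝ`. -/
abbrev SampleSpace (ψ : ℝ → EReal) : Type := effDom (conjugate ψ)

/-- A probability measure on `ℝ` is sub-`ψ` if `∫ exp (l x) μ(dx) ≤ exp (ψ l)` for all `l` in the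
effective domain of `ψ`. -/
def IsSubPsi (ψ : ℝ → EReal) (μ : Measure ℝ) : Prop :=
  IsProbabilityMeasure μ ∧ ∀ l ∈ effDom ψ,
    ∫⁻ x, ENNReal.ofReal (Real.exp (l * x)) ∂μ ≤ ENNReal.ofReal (Real.exp (ψ l).toReal)

/-- The sub-`ψ` distributions, regarded as measures on the effective domain of `ψ^*`. -/
def subPsiHypothesis (ψ : ℝ → EReal) : Set (Measure (SampleSpace ψ)) :=
  {μ | IsSubPsi ψ (μ.map Subtype.val)}

/-- The compact index set `Λ = [0, lmax]`, a subspace of the extended reals (`lmax` may be `∞`). -/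
abbrev IndexSpace (lmax : EReal) : Type := Icc (0 : EReal) lmax

open Classical in
/-- The function `exp (l x - ψ l)` for a real `l` in the effective domain of `ψ`. The only other
index in `[0, lmax]` is `lmax` itself when it lies outside the effective domain, where the function
is defined as the limit as `t` increases to `lmax`. -/
def expKernel (ψ : ℝ → EReal) (l : EReal) (x : ℝ) : ℝ :=
  if l < ⊤ ∧ l.toReal ∈ effDom ψ then Real.exp (l.toReal * x - (ψ l.toReal).toReal)
  else limUnder (𝓝[<] l) fun t : EReal => Real.exp (t.toReal * x - (ψ t.toReal).toReal)

/-- The constraint function `g_l = exp (l x - ψ l) - 1` on the effective domain of `ψ^*`. -/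
def constraintFun (ψ : ℝ → EReal) (lmax : EReal) (l : IndexSpace lmax) (x : SampleSpace ψ) : ℝ :=
  expKernel ψ l x - 1

/-- The full constraint set `Φ = {g_l : l ∈ [0, lmax]}`. -/
def constraintSet (ψ : ℝ → EReal) (lmax : EReal) : Set (SampleSpace ψ → ℝ) :=
  range (constraintFun ψ lmax)

end EVar

end

/-!
The easy directions are Tonelli's theorem: the kernel `exp (l x - ψ l)` is nonnegative, measurable
in `x` and continuous in `l`, and its expectation under a sub-`ψ` distribution is at most one for
every index `l ∈ [0, lmax]` (at an endpoint outside the effective domain by Fatou's lemma).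

Continuity in `l` on the compact interval `[0, lmax]` is where convexity and closedness of `ψ`
enter. Inside the domain it is continuity of `ψ`. At an endpoint outside the domain, the concave
exponent `l x - ψ l` is bounded above by the conjugate of `ψ` at `x`, hence is eventually monotone
or antitone, so that its exponential converges (`IsAdmissible.exists_tendsto_exp`).

For the converse directions, a mixing measure is a positive linear functional on the continuous
functions on `[0, lmax]`. The M. Riesz extension theorem and the Riesz–Markov–Kakutani theorem
reduce its existence to finitely many points `x` at a time
(`exists_measure_forall_le_integral`): for finite nonnegative weights `w` with
`∑ w g_l ≤ a` for all `l`, one needs `∑ w f ≤ B a` with `B` independent of `w`. There is no Slater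
point, because `g_0 = 0`. What replaces it is that a far-away negative point `-N` has `g_l (-N)`
close to `-1` unless `l` is close to `0`: adding any mass `t > a` at `-N`, with `N` large depending
on `w`, produces a sub-`ψ` distribution (`IsAdmissible.exists_add_single_mem`). Hence
`∑ w f + t f (-N) ≤ 0`, and `B` can be any bound with `f ≥ -B` on the nonpositive half-line. Such a
bound exists because every probability measure on that half-line is sub-`ψ` and `f` is integrable
under all of them (`IsAdmissible.exists_neg_le_of_nonpos`). For an e-variable `h` the function
`h - 1` admits `B = 1`, which makes the mixing measure a probability measure.
-/

namespace EVar

open scoped NNReal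

/-! ### Domination by mixtures over a compact index space -/

section Abstract

variable {L X : Type*} [TopologicalSpace L] [CompactSpace L] [T2Space L] [MeasurableSpace L]
  [BorelSpace L]

/-- A positive linear functional on the continuous functions on a compact Hausdorff space is
integration against a finite Borel measure. -/
theorem exists_measure_of_positive (ℓ : C(L, ℝ) →ₗ[ℝ] ℝ) (hℓ : ∀ u, 0 ≤ u → 0 ≤ ℓ u) :
    ∃ π : Measure L, IsFiniteMeasure π ∧ ∀ u : C(L, ℝ), ∫ l, u l ∂π = ℓ u := by
  let F : CompactlySupportedContinuousMap L ℝ →ₗ[ℝ] ℝ :=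
    { toFun := fun u => ℓ u.toContinuousMap
      map_add' := fun u v => ℓ.map_add u.toContinuousMap v.toContinuousMap
      map_smul' := fun c u => ℓ.map_smul c u.toContinuousMap }
  let Fp := PositiveLinearMap.mk₀ F fun u hu => hℓ u.toContinuousMap hu
  refine ⟨RealRMK.rieszMeasure Fp, ⟨isCompact_univ.measure_lt_top⟩, fun u => ?_⟩
  exact RealRMK.integral_rieszMeasure Fp (CompactlySupportedContinuousMap.continuousMapEquiv u)

/-- A Mazur–Orlicz type theorem. The inequalities `f x ≤ ∫ G x dπ`, for possibly infinitely many
`x`, have a common solution `π` of mass `M` as soon as every finite nonnegative combination of them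
is compatible with the upper bound `M * sup u` for the integral of `u`. -/
theorem exists_measure_forall_le_integral [Nonempty L] (G : X → C(L, ℝ)) (f : X → ℝ) (M : ℝ)
    (H : ∀ (w : X →₀ ℝ≥0) (a : ℝ), (∀ l, (w.sum fun x c => (c : ℝ) * G x l) ≤ a) →
      (w.sum fun x c => (c : ℝ) * f x) ≤ M * a) :
    ∃ π : Measure L, IsFiniteMeasure π ∧ π univ = ENNReal.ofReal M ∧
      ∀ x, f x ≤ ∫ l, G x l ∂π := by
  obtain ⟨l₀⟩ := ‹Nonempty L›
  -- The cone generated by the nonnegative functions and the pairs `(G x, -f x)`; the functional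
  -- `(a, b) ↦ M * a + b` on constants is nonnegative on it, hence extends by M. Riesz.
  let T : (X →₀ ℝ≥0) →ₗ[ℝ≥0] C(L, ℝ) × ℝ :=
    Finsupp.linearCombination ℝ≥0 fun x => (G x, -f x)
  have hT1 : ∀ w l, (T w).1 l = w.sum fun x c => (c : ℝ) * G x l := by
    intro w l
    simp only [T, Finsupp.linearCombination_apply, Finsupp.sum, Prod.fst_sum,
      ContinuousMap.sum_apply]
    rfl
  have hT2 : ∀ w, (T w).2 = -w.sum fun x c => (c : ℝ) * f x := by
    intro w
    simp only [T, Finsupp.linearCombination_apply, Finsupp.sum, Prod.snd_sum,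
      ← Finset.sum_neg_distrib, ← mul_neg]
    rfl
  let K : PointedCone ℝ (C(L, ℝ) × ℝ) :=
    { carrier := {p | ∃ w : X →₀ ℝ≥0, (∀ l, (T w).1 l ≤ p.1 l) ∧ p.2 = (T w).2}
      zero_mem' := ⟨0, fun l => by simp, by simp⟩
      add_mem' := by
        rintro p q ⟨w, hw, hw'⟩ ⟨v, hv, hv'⟩
        refine ⟨w + v, fun l => ?_, ?_⟩
        · rw [map_add]; exact add_le_add (hw l) (hv l)
        · rw [map_add, Prod.snd_add, Prod.snd_add, hw', hv']
      smul_mem' := by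
        rintro c p ⟨w, hw, hw'⟩
        refine ⟨(show ℝ≥0 from c) • w, fun l => ?_, ?_⟩
        · rw [map_smul]; exact mul_le_mul_of_nonneg_left (hw l) c.2
        · rw [map_smul, Prod.smul_snd, Prod.smul_snd, hw']; rfl }
  have hK : ∀ p, p ∈ K ↔ ∃ w : X →₀ ℝ≥0, (∀ l, (T w).1 l ≤ p.1 l) ∧ p.2 = (T w).2 :=
    fun p => Iff.rfl
  let ev : C(L, ℝ) × ℝ →ₗ[ℝ] ℝ :=
    { toFun := fun p => M * p.1 l₀ + p.2
      map_add' := fun p q => by simp; ring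
      map_smul' := fun c p => by simp; ring }
  let S : Submodule ℝ (C(L, ℝ) × ℝ) := (Submodule.span ℝ {(1 : C(L, ℝ))}).prod ⊤
  have hS : ∀ a b : ℝ, (a • (1 : C(L, ℝ)), b) ∈ S := fun a b =>
    ⟨Submodule.mem_span_singleton.2 ⟨a, rfl⟩, trivial⟩
  have hnonneg : ∀ p : S, (p : C(L, ℝ) × ℝ) ∈ K → 0 ≤ ev.domRestrict S p := by
    rintro ⟨⟨u, b⟩, hu, _⟩ hmem
    obtain ⟨a, rfl⟩ := Submodule.mem_span_singleton.1 hu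
    obtain ⟨w, hw, hw'⟩ := (hK _).1 hmem
    have := H w a fun l => by simpa [hT1] using hw l
    simp only [hT2] at hw'
    change 0 ≤ M * (a • (1 : C(L, ℝ))) l₀ + b
    simp only [ContinuousMap.smul_apply, ContinuousMap.one_apply, smul_eq_mul, mul_one]
    linarith
  have hcofinal : ∀ q, ∃ p : S, (p : C(L, ℝ) × ℝ) + q ∈ K := by
    rintro ⟨u, b⟩
    refine ⟨⟨(‖u‖ • 1, -b), hS _ _⟩, (hK _).2 ⟨0, fun l => ?_, by simp⟩⟩
    have := neg_le_of_abs_le (u.norm_coe_le_norm l)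
    simp
    linarith
  obtain ⟨g, hg, hgK⟩ := riesz_extension K ⟨S, ev.domRestrict S⟩ hnonneg hcofinal
  have hg' : ∀ a b : ℝ, g (a • (1 : C(L, ℝ)), b) = M * a + b := fun a b => by
    rw [hg ⟨_, hS a b⟩]
    change M * (a • (1 : C(L, ℝ))) l₀ + b = _
    simp
  obtain ⟨π, hπ, hint⟩ := exists_measure_of_positive (g.comp (LinearMap.inl ℝ _ ℝ)) fun u hu =>
    hgK _ ((hK _).2 ⟨0, fun l => by simpa using hu l, by simp⟩)
  refine ⟨π, hπ, ?_, fun x => ?_⟩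
  · have h1 := hint 1
    have h2 := hg' 1 0
    simp only [one_smul, mul_one, add_zero] at h2
    simp only [ContinuousMap.one_apply, integral_const, smul_eq_mul, mul_one,
      LinearMap.comp_apply, LinearMap.inl_apply, h2] at h1
    rw [← h1, measureReal_def, ENNReal.ofReal_toReal (measure_ne_top _ _)]
  · have h1 : 0 ≤ g (G x, -f x) := hgK _ ((hK _).2
      ⟨Finsupp.single x 1, fun l => by simp [T], by simp [T]⟩)
    have h2 : ((G x, -f x) : C(L, ℝ) × ℝ) = (G x, 0) + ((0 : ℝ) • (1 : C(L, ℝ)), -f x) := by simp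
    rw [h2, map_add, hg'] at h1
    have h3 := hint (G x)
    simp only [LinearMap.comp_apply, LinearMap.inl_apply] at h3
    linarith

end Abstract

/-! ### Regularity of a closed convex `ψ` on its effective domain -/

section Regularity

variable {ψ : ℝ → EReal} {lmax : EReal}

theorem IsAdmissible.mem_effDom (hψ : IsAdmissible ψ lmax) {l : ℝ} (h0 : 0 ≤ l)
    (hl : (l : EReal) < lmax) : l ∈ effDom ψ := by
  rcases hψ.effDom_eq with h | ⟨-, h⟩ <;> rw [h]
  exacts [⟨h0, hl⟩, ⟨h0, hl.le⟩]

theorem IsAdmissible.nonneg_of_mem (hψ : IsAdmissible ψ lmax) {l : ℝ} (hl : l ∈ effDom ψ) :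
    0 ≤ l := by
  rcases hψ.effDom_eq with h | ⟨-, h⟩ <;> rw [h] at hl <;> exact hl.1

theorem IsAdmissible.le_lmax (hψ : IsAdmissible ψ lmax) {l : ℝ} (hl : l ∈ effDom ψ) :
    (l : EReal) ≤ lmax := by
  rcases hψ.effDom_eq with h | ⟨-, h⟩ <;> rw [h] at hl
  exacts [hl.2.le, hl.2]

theorem IsAdmissible.zero_mem (hψ : IsAdmissible ψ lmax) : (0 : ℝ) ∈ effDom ψ :=
  hψ.mem_effDom le_rfl (by simpa using hψ.lmax_pos)

theorem IsAdmissible.coe_mem_Icc (hψ : IsAdmissible ψ lmax) {l : ℝ} (hl : l ∈ effDom ψ) :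
    (l : EReal) ∈ Icc 0 lmax :=
  ⟨by exact_mod_cast hψ.nonneg_of_mem hl, hψ.le_lmax hl⟩

theorem IsAdmissible.coe_toReal (hψ : IsAdmissible ψ lmax) {l : ℝ} (hl : l ∈ effDom ψ) :
    ((ψ l).toReal : EReal) = ψ l :=
  EReal.coe_toReal (ne_of_lt hl) (ne_of_gt (lt_of_lt_of_le (by simp) (hψ.nonneg l)))

theorem IsAdmissible.toReal_nonneg (hψ : IsAdmissible ψ lmax) (l : ℝ) : 0 ≤ (ψ l).toReal :=
  EReal.toReal_nonneg (hψ.nonneg l)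

/-- Every index in `[0, lmax]` other than `lmax` is a real number in the effective domain. -/
theorem IsAdmissible.exists_real_of_lt (hψ : IsAdmissible ψ lmax) {l : EReal} (h0 : 0 ≤ l)
    (hl : l < lmax) : ∃ t ∈ effDom ψ, (t : EReal) = l := by
  have h : ((l.toReal : ℝ) : EReal) = l :=
    EReal.coe_toReal (ne_top_of_lt hl) (ne_of_gt (lt_of_lt_of_le (by simp) h0))
  exact ⟨l.toReal, hψ.mem_effDom (EReal.toReal_nonneg h0) (by rwa [h]), h⟩

theorem IsAdmissible.convexOn (hψ : IsAdmissible ψ lmax) :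
    ConvexOn ℝ (effDom ψ) fun l => (ψ l).toReal := by
  have key : ∀ x ∈ effDom ψ, ∀ y ∈ effDom ψ, ∀ a b : ℝ, 0 ≤ a → 0 ≤ b → a + b = 1 →
      ψ (a * x + b * y) ≤ ((a * (ψ x).toReal + b * (ψ y).toReal : ℝ) : EReal) := by
    intro x hx y hy a b ha hb hab
    exact hψ.convex_epigraph (x := (x, (ψ x).toReal)) (hψ.coe_toReal hx).ge
      (y := (y, (ψ y).toReal)) (hψ.coe_toReal hy).ge ha hb hab
  have hconv : ∀ x ∈ effDom ψ, ∀ y ∈ effDom ψ, ∀ a b : ℝ, 0 ≤ a → 0 ≤ b → a + b = 1 →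
      a * x + b * y ∈ effDom ψ := fun x hx y hy a b ha hb hab =>
    (key x hx y hy a b ha hb hab).trans_lt (EReal.coe_lt_top _)
  refine ⟨fun x hx y hy a b ha hb hab => hconv x hx y hy a b ha hb hab,
    fun x hx y hy a b ha hb hab => ?_⟩
  have h1 := key x hx y hy a b ha hb hab
  rw [← hψ.coe_toReal (hconv x hx y hy a b ha hb hab)] at h1
  exact EReal.coe_le_coe_iff.1 h1

theorem IsAdmissible.monotoneOn (hψ : IsAdmissible ψ lmax) :
    MonotoneOn (fun l => (ψ l).toReal) (effDom ψ) := by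
  intro x hx y hy hxy
  rcases (hψ.nonneg_of_mem hy).eq_or_lt with h | h
  · have : x = y := le_antisymm hxy (h ▸ hψ.nonneg_of_mem hx)
    rw [this]
  · have h1 : 0 ≤ x / y := div_nonneg (hψ.nonneg_of_mem hx) h.le
    have h2 : x / y ≤ 1 := (div_le_one h).2 hxy
    have h3 := hψ.convexOn.2 hψ.zero_mem hy (sub_nonneg.2 h2) h1 (by ring)
    simp only [smul_eq_mul, mul_zero, zero_add, div_mul_cancel₀ _ h.ne', hψ.map_zero,
      EReal.toReal_zero] at h3
    exact h3.trans (mul_le_of_le_one_left (hψ.toReal_nonneg y) h2)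

theorem IsAdmissible.lowerSemicontinuousOn (hψ : IsAdmissible ψ lmax) :
    LowerSemicontinuousOn (fun l => (ψ l).toReal) (effDom ψ) := by
  intro x hx c hc
  have hclosed : IsClosed {l : ℝ | ψ l ≤ (c : EReal)} :=
    hψ.closed_epigraph.preimage (f := fun l : ℝ => (l, c)) (by fun_prop)
  have hx' : x ∈ {l : ℝ | ψ l ≤ (c : EReal)}ᶜ := by
    rw [mem_compl_iff, mem_ofPred_eq, not_le, ← hψ.coe_toReal hx]
    exact_mod_cast hc
  filter_upwards [mem_nhdsWithin_of_mem_nhds (hclosed.isOpen_compl.mem_nhds hx'),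
    self_mem_nhdsWithin] with l hl hl'
  rw [mem_compl_iff, mem_ofPred_eq, not_le, ← hψ.coe_toReal hl'] at hl
  exact_mod_cast hl

/-- Convexity gives continuity in the interior and at `0`, and upper semicontinuity at a right
endpoint of the domain; closedness of the epigraph supplies lower semicontinuity there. -/
theorem IsAdmissible.continuousOn (hψ : IsAdmissible ψ lmax) :
    ContinuousOn (fun l => (ψ l).toReal) (effDom ψ) := by
  intro x hx
  by_cases hmax : ∃ y ∈ effDom ψ, x < y
  · obtain ⟨y, hy, hxy⟩ := hmax
    rcases (hψ.nonneg_of_mem hx).eq_or_lt with rfl | h0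
    · -- near `0`, the function is squeezed between `0` and a chord
      have hbound : ∀ᶠ l in 𝓝[effDom ψ] (0 : ℝ), (ψ l).toReal ≤ l / y * (ψ y).toReal := by
        filter_upwards [self_mem_nhdsWithin, mem_nhdsWithin_of_mem_nhds (Iio_mem_nhds hxy)]
          with l hl hly
        have h3 := hψ.convexOn.2 hψ.zero_mem hy (sub_nonneg.2 ((div_le_one hxy).2 (le_of_lt hly)))
          (div_nonneg (hψ.nonneg_of_mem hl) hxy.le) (by ring)
        simpa [hψ.map_zero, div_mul_cancel₀ _ hxy.ne'] using h3
      have hlim : Tendsto (fun l : ℝ => l / y * (ψ y).toReal) (𝓝[effDom ψ] 0) (𝓝 0) := by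
        have : Continuous fun l : ℝ => l / y * (ψ y).toReal := by fun_prop
        simpa using (this.tendsto 0).mono_left nhdsWithin_le_nhds
      have h := tendsto_of_tendsto_of_tendsto_of_le_of_le' tendsto_const_nhds hlim
        (Eventually.of_forall fun l => hψ.toReal_nonneg l) hbound
      simpa [ContinuousWithinAt, hψ.map_zero] using h
    · have hint : x ∈ interior (effDom ψ) := by
        refine mem_interior.2 ⟨Ioo 0 y, fun z hz => ?_, isOpen_Ioo, h0, hxy⟩
        exact hψ.mem_effDom hz.1.le
          (lt_of_lt_of_le (EReal.coe_lt_coe_iff.2 hz.2) (hψ.le_lmax hy))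
      exact ((hψ.convexOn.continuousOn_interior x hint).continuousAt
        (isOpen_interior.mem_nhds hint)).continuousWithinAt
  · push Not at hmax
    refine continuousWithinAt_iff_lower_upperSemicontinuousWithinAt.2
      ⟨hψ.lowerSemicontinuousOn x hx, fun c hc => ?_⟩
    filter_upwards [self_mem_nhdsWithin] with l hl
    exact (hψ.monotoneOn hl hx (hmax l hl)).trans_lt hc

end Regularity

/-! ### The sample space and the exponential kernel -/

section Kernel

variable {ψ : ℝ → EReal} {lmax : EReal}

theorem IsAdmissible.mem_sampleSpace_of_nonpos (hψ : IsAdmissible ψ lmax) {x : ℝ} (hx : x ≤ 0) :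
    x ∈ effDom (conjugate ψ) := by
  refine lt_of_le_of_lt (iSup_le fun l => ?_) EReal.zero_lt_top
  by_cases hl : l ∈ effDom ψ
  · rw [← hψ.coe_toReal hl, ← EReal.coe_sub]
    have := mul_nonpos_of_nonneg_of_nonpos (hψ.nonneg_of_mem hl) hx
    have h2 := hψ.toReal_nonneg l
    exact_mod_cast (by linarith : l * x - (ψ l).toReal ≤ 0)
  · rw [effDom, mem_ofPred_eq, not_lt_top_iff] at hl
    simp [hl]

/-- On the sample space the exponents `l x - ψ l` are bounded above in `l`. -/
theorem IsAdmissible.exists_exponent_le (hψ : IsAdmissible ψ lmax) (x : SampleSpace ψ) :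
    ∃ C : ℝ, ∀ l ∈ effDom ψ, l * x - (ψ l).toReal ≤ C := by
  have hle : ∀ l ∈ effDom ψ, ((l * x - (ψ l).toReal : ℝ) : EReal) ≤ conjugate ψ x := by
    intro l hl
    rw [EReal.coe_sub, hψ.coe_toReal hl]
    exact le_iSup (fun l : ℝ => ((l * x : ℝ) : EReal) - ψ l) l
  refine ⟨(conjugate ψ x).toReal, fun l hl => EReal.coe_le_coe_iff.1 ?_⟩
  rw [EReal.coe_toReal (ne_of_lt x.2)]
  · exact hle l hl
  · exact ne_of_gt (lt_of_lt_of_le (EReal.bot_lt_coe _) (hle 0 hψ.zero_mem))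

theorem expKernel_coe {l : ℝ} (hl : l ∈ effDom ψ) (x : ℝ) :
    expKernel ψ l x = Real.exp (l * x - (ψ l).toReal) := by
  simp [expKernel, hl]

/-- The exponent is concave and bounded above in `l`, so its exponential is bounded and monotone
or antitone near `lmax`; hence it converges as `l` increases to `lmax`. -/
theorem IsAdmissible.exists_tendsto_exp (hψ : IsAdmissible ψ lmax) (x : SampleSpace ψ) :
    ∃ a : ℝ, Tendsto (fun t : EReal => Real.exp (t.toReal * x - (ψ t.toReal).toReal))
      (𝓝[<] lmax) (𝓝 a) := by
  obtain ⟨C, hC⟩ := hψ.exists_exponent_le x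
  set q : ℝ → ℝ := fun l => l * x - (ψ l).toReal with hq
  have hconc : ConcaveOn ℝ (effDom ψ) q :=
    ((LinearMap.mulRight ℝ (x : ℝ)).concaveOn hψ.convexOn.1).sub hψ.convexOn
  by_cases hmono : MonotoneOn q (effDom ψ)
  · refine ⟨_, MonotoneOn.tendsto_nhdsWithin_Ioo_left (nonempty_Ioo.2 hψ.lmax_pos) ?_ ?_⟩
    · intro s hs t ht hst
      obtain ⟨s, hs', rfl⟩ := hψ.exists_real_of_lt hs.1.le hs.2
      obtain ⟨t, ht', rfl⟩ := hψ.exists_real_of_lt ht.1.le ht.2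
      exact Real.exp_le_exp.2 (hmono hs' ht' (EReal.coe_le_coe_iff.1 hst))
    · refine ⟨Real.exp C, ?_⟩
      rintro _ ⟨t, ht, rfl⟩
      obtain ⟨t, ht', rfl⟩ := hψ.exists_real_of_lt ht.1.le ht.2
      exact Real.exp_le_exp.2 (hC t ht')
  · simp only [MonotoneOn, not_forall, not_le] at hmono
    obtain ⟨a, ha, b, hb, hab, hlt⟩ := hmono
    have hab' : a < b := lt_of_le_of_ne hab fun h => by simp [h] at hlt
    have hanti := (hconc.strictAntiOn ha hab' hlt).antitoneOn
    by_cases hbl : (b : EReal) < lmax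
    · refine ⟨_, AntitoneOn.tendsto_nhdsWithin_Ioo_left (nonempty_Ioo.2 hbl) ?_ ?_⟩
      · intro s hs t ht hst
        have h0 : (0 : EReal) ≤ b := (hψ.coe_mem_Icc hb).1
        obtain ⟨s, hs', rfl⟩ := hψ.exists_real_of_lt (h0.trans hs.1.le) hs.2
        obtain ⟨t, ht', rfl⟩ := hψ.exists_real_of_lt (h0.trans ht.1.le) ht.2
        exact Real.exp_le_exp.2 (hanti ⟨hs', EReal.coe_le_coe_iff.1 hs.1.le⟩
          ⟨ht', EReal.coe_le_coe_iff.1 ht.1.le⟩ (EReal.coe_le_coe_iff.1 hst))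
      · refine ⟨0, ?_⟩
        rintro _ ⟨t, -, rfl⟩
        exact (Real.exp_pos _).le
    · -- here `lmax = b` lies in the domain, on which the exponent is continuous
      obtain rfl : lmax = b := le_antisymm (not_lt.1 hbl) (hψ.le_lmax hb)
      have hcont : ContinuousOn (fun l => Real.exp (q l)) (effDom ψ) :=
        Real.continuous_exp.comp_continuousOn
          ((by fun_prop : Continuous fun l : ℝ => l * (x : ℝ)).continuousOn.sub hψ.continuousOn)
      refine ⟨Real.exp (q b), (hcont b hb).tendsto.comp (f := EReal.toReal)
        (tendsto_nhdsWithin_iff.2 ⟨?_, ?_⟩)⟩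
      · exact (EReal.tendsto_toReal (EReal.coe_ne_top b) (EReal.coe_ne_bot b)).mono_left
          nhdsWithin_le_nhds
      · filter_upwards [Ioo_mem_nhdsLT hψ.lmax_pos] with t ht
        obtain ⟨t, ht', rfl⟩ := hψ.exists_real_of_lt ht.1.le ht.2
        exact ht'

theorem IsAdmissible.continuousOn_expKernel (hψ : IsAdmissible ψ lmax) (x : SampleSpace ψ) :
    ContinuousOn (fun l => expKernel ψ l x) (Icc 0 lmax) := by
  have hcont : ContinuousOn (fun l : ℝ => Real.exp (l * x - (ψ l).toReal)) (effDom ψ) :=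
    Real.continuous_exp.comp_continuousOn
      ((by fun_prop : Continuous fun l : ℝ => l * (x : ℝ)).continuousOn.sub hψ.continuousOn)
  -- at a real index in the domain, provided the nearby indices lie in the domain as well
  have hreal : ∀ t ∈ effDom ψ, (∀ᶠ s in 𝓝[Icc 0 lmax] (t : EReal), s < ⊤ ∧ s.toReal ∈ effDom ψ) →
      ContinuousWithinAt (fun l => expKernel ψ l x) (Icc 0 lmax) t := by
    intro t ht hev
    have h1 : Tendsto EReal.toReal (𝓝[Icc 0 lmax] (t : EReal)) (𝓝[effDom ψ] t) :=
      tendsto_nhdsWithin_iff.2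
        ⟨(EReal.tendsto_toReal (EReal.coe_ne_top t) (EReal.coe_ne_bot t)).mono_left
          nhdsWithin_le_nhds, hev.mono fun s hs => hs.2⟩
    have h2 := (hcont t ht).tendsto.comp h1
    rw [ContinuousWithinAt, expKernel_coe ht]
    refine h2.congr' (hev.mono fun s hs => ?_)
    simp [expKernel, hs]
  have hlt : ∀ s : EReal, 0 ≤ s → s < lmax → s < ⊤ ∧ s.toReal ∈ effDom ψ := by
    intro s h0 hs
    obtain ⟨t, ht, rfl⟩ := hψ.exists_real_of_lt h0 hs
    exact ⟨EReal.coe_lt_top t, ht⟩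
  intro l hl
  rcases hl.2.lt_or_eq with hl' | rfl
  · obtain ⟨t, ht, rfl⟩ := hψ.exists_real_of_lt hl.1 hl'
    refine hreal t ht ?_
    filter_upwards [self_mem_nhdsWithin, mem_nhdsWithin_of_mem_nhds (Iio_mem_nhds hl')]
      with s hs hs'
    exact hlt s hs.1 hs'
  · by_cases hmem : l < ⊤ ∧ l.toReal ∈ effDom ψ
    · have hcoe : ((l.toReal : ℝ) : EReal) = l :=
        EReal.coe_toReal hmem.1.ne (ne_of_gt (lt_of_lt_of_le (by simp) hl.1))
      have h := hreal l.toReal hmem.2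
      rw [hcoe] at h
      refine h ?_
      filter_upwards [self_mem_nhdsWithin] with s hs
      rcases hs.2.lt_or_eq with hs' | rfl
      exacts [hlt s hs.1 hs', hmem]
    · obtain ⟨a, ha⟩ := hψ.exists_tendsto_exp x
      have : (𝓝[<] l).NeBot := nhdsLT_neBot_of_exists_lt ⟨0, hψ.lmax_pos⟩
      have hval : expKernel ψ l x = a := by
        rw [expKernel, if_neg hmem]
        exact ha.limUnder_eq
      have hlim : Tendsto (fun s => expKernel ψ s x) (𝓝[<] l) (𝓝 (expKernel ψ l x)) := by
        rw [hval]
        refine ha.congr' ?_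
        filter_upwards [Ioo_mem_nhdsLT hψ.lmax_pos] with s hs
        simp [expKernel, hlt s hs.1.le hs.2]
      exact ((continuousWithinAt_Iio_iff_Iic (a := l) (f := fun s => expKernel ψ s x)).1
        hlim).mono fun s hs => hs.2

theorem IsAdmissible.continuous_expKernel (hψ : IsAdmissible ψ lmax) (x : SampleSpace ψ) :
    Continuous fun l : IndexSpace lmax => expKernel ψ l x :=
  continuousOn_iff_continuous_domRestrict.1 (hψ.continuousOn_expKernel x)

/-- Every index in `[0, lmax]` is a limit of real indices in the effective domain. -/
theorem IsAdmissible.exists_seq_tendsto (hψ : IsAdmissible ψ lmax) (l : IndexSpace lmax) :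
    ∃ s : ℕ → ℝ, (∀ n, s n ∈ effDom ψ) ∧
      ∀ x : SampleSpace ψ, Tendsto (fun n => expKernel ψ (s n) x) atTop (𝓝 (expKernel ψ l x)) := by
  rcases l.2.2.lt_or_eq with hl | hl
  · obtain ⟨t, ht, htl⟩ := hψ.exists_real_of_lt l.2.1 hl
    exact ⟨fun _ => t, fun _ => ht, fun x => by simp only [htl]; exact tendsto_const_nhds⟩
  · have : (𝓝[<] lmax).NeBot := nhdsLT_neBot_of_exists_lt ⟨0, hψ.lmax_pos⟩
    have : (𝓝[Ioo 0 lmax] lmax).NeBot := by rwa [nhdsWithin_Ioo_eq_nhdsLT hψ.lmax_pos]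
    obtain ⟨u, hu⟩ := Filter.exists_seq_tendsto (𝓝[Ioo 0 lmax] lmax)
    obtain ⟨N, hN⟩ := eventually_atTop.1 (hu.eventually self_mem_nhdsWithin)
    have hN' : ∀ n, u (n + N) ∈ Ioo 0 lmax := fun n => hN _ (Nat.le_add_left N n)
    choose s hs hsu using fun n => hψ.exists_real_of_lt (hN' n).1.le (hN' n).2
    refine ⟨s, hs, fun x => ?_⟩
    simp only [hsu]
    rw [hl]
    exact (hψ.continuousOn_expKernel x lmax (right_mem_Icc.2 hψ.lmax_pos.le)).tendsto.comp
      ((hu.mono_right (nhdsWithin_mono _ Ioo_subset_Icc_self)).comp (tendsto_add_atTop_nat N))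

theorem IsAdmissible.expKernel_nonneg (hψ : IsAdmissible ψ lmax) (l : IndexSpace lmax)
    (x : SampleSpace ψ) : 0 ≤ expKernel ψ l x := by
  obtain ⟨s, hs, hlim⟩ := hψ.exists_seq_tendsto l
  refine ge_of_tendsto' (hlim x) fun n => ?_
  rw [expKernel_coe (hs n)]
  exact (Real.exp_pos _).le

theorem IsAdmissible.measurable_expKernel (hψ : IsAdmissible ψ lmax) (l : IndexSpace lmax) :
    Measurable fun x : SampleSpace ψ => expKernel ψ l x := by
  obtain ⟨s, hs, hlim⟩ := hψ.exists_seq_tendsto l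
  refine measurable_of_tendsto_metrizable (fun n => ?_) (tendsto_pi_nhds.2 hlim)
  simp only [expKernel_coe (hs n)]
  fun_prop

end Kernel

/-! ### Characterizations of the hypothesis -/

section Hypothesis

variable {ψ : ℝ → EReal} {lmax : EReal}

theorem mem_subPsiHypothesis_iff {μ : Measure (SampleSpace ψ)} :
    μ ∈ subPsiHypothesis ψ ↔ IsProbabilityMeasure μ ∧ ∀ l ∈ effDom ψ,
      ∫⁻ x : SampleSpace ψ, ENNReal.ofReal (expKernel ψ l x) ∂μ ≤ 1 := by
  have key : ∀ l ∈ effDom ψ,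
      (∫⁻ x, ENNReal.ofReal (Real.exp (l * x)) ∂(μ.map Subtype.val) ≤
        ENNReal.ofReal (Real.exp (ψ l).toReal) ↔
      ∫⁻ x : SampleSpace ψ, ENNReal.ofReal (expKernel ψ l x) ∂μ ≤ 1) := by
    intro l hl
    have hmeas : Measurable fun x : SampleSpace ψ => ENNReal.ofReal (expKernel ψ l x) := by
      simp only [expKernel_coe hl]
      fun_prop
    have heq : ∀ x : SampleSpace ψ, ENNReal.ofReal (Real.exp (l * x)) =
        ENNReal.ofReal (Real.exp (ψ l).toReal) * ENNReal.ofReal (expKernel ψ l x) := by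
      intro x
      rw [expKernel_coe hl, ← ENNReal.ofReal_mul (Real.exp_pos _).le, ← Real.exp_add]
      congr 2
      ring
    rw [lintegral_map (by fun_prop) measurable_subtype_coe]
    simp only [heq]
    rw [lintegral_const_mul _ hmeas]
    nth_rw 2 [← mul_one (ENNReal.ofReal (Real.exp (ψ l).toReal))]
    exact ENNReal.mul_le_mul_iff_right (by simp [Real.exp_pos]) ENNReal.ofReal_ne_top
  constructor
  · rintro ⟨h1, h2⟩
    exact ⟨Measure.isProbabilityMeasure_of_map Subtype.val, fun l hl => (key l hl).1 (h2 l hl)⟩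
  · rintro ⟨h1, h2⟩
    exact ⟨Measure.isProbabilityMeasure_map measurable_subtype_coe.aemeasurable,
      fun l hl => (key l hl).2 (h2 l hl)⟩

/-- The constraint extends to an index `lmax` outside the effective domain by Fatou's lemma. -/
theorem IsAdmissible.lintegral_expKernel_le_one (hψ : IsAdmissible ψ lmax)
    {μ : Measure (SampleSpace ψ)} (hμ : μ ∈ subPsiHypothesis ψ) (l : IndexSpace lmax) :
    ∫⁻ x : SampleSpace ψ, ENNReal.ofReal (expKernel ψ l x) ∂μ ≤ 1 := by
  obtain ⟨s, hs, hlim⟩ := hψ.exists_seq_tendsto l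
  have h := (mem_subPsiHypothesis_iff.1 hμ).2
  calc ∫⁻ x : SampleSpace ψ, ENNReal.ofReal (expKernel ψ l x) ∂μ
      = ∫⁻ x : SampleSpace ψ,
          liminf (fun n => ENNReal.ofReal (expKernel ψ (s n) x)) atTop ∂μ := by
        congr 1 with x
        exact ((ENNReal.continuous_ofReal.tendsto _).comp (hlim x)).liminf_eq.symm
    _ ≤ liminf (fun n => ∫⁻ x : SampleSpace ψ, ENNReal.ofReal (expKernel ψ (s n) x) ∂μ) atTop :=
        lintegral_liminf_le fun n =>
          (hψ.measurable_expKernel ⟨s n, hψ.coe_mem_Icc (hs n)⟩).ennreal_ofReal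
    _ ≤ 1 := by
        refine (liminf_le_liminf (Eventually.of_forall fun n => h _ (hs n))).trans ?_
        simp

theorem integrable_and_integral_sub_one_nonpos_iff {X : Type*} [MeasurableSpace X] {μ : Measure X}
    [IsProbabilityMeasure μ] {e : X → ℝ} (he : Measurable e) (h0 : ∀ x, 0 ≤ e x) :
    (Integrable (fun x => e x - 1) μ ∧ ∫ x, (e x - 1) ∂μ ≤ 0) ↔
      ∫⁻ x, ENNReal.ofReal (e x) ∂μ ≤ 1 := by
  have hint : Integrable (fun x => e x - 1) μ ↔ Integrable e μ :=
    ⟨fun h => (h.add (integrable_const 1)).congr (ae_of_all _ fun x => by simp), fun h => h.sub (integrable_const 1)⟩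
  have hval : Integrable e μ → (∫ x, (e x - 1) ∂μ ≤ 0 ↔ ∫⁻ x, ENNReal.ofReal (e x) ∂μ ≤ 1) := by
    intro h
    rw [integral_sub h (integrable_const 1),
      ← ofReal_integral_eq_lintegral_ofReal h (Eventually.of_forall h0)]
    simp
  rw [hint]
  refine ⟨fun ⟨h, h'⟩ => (hval h).1 h', fun h => ?_⟩
  have h1 : Integrable e μ := (lintegral_ofReal_ne_top_iff_integrable he.aestronglyMeasurable
    (Eventually.of_forall h0)).1 (h.trans_lt ENNReal.one_lt_top).ne
  exact ⟨h1, (hval h1).2 h⟩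

theorem IsAdmissible.generatedHypothesis_constraintSet (hψ : IsAdmissible ψ lmax) :
    generatedHypothesis (constraintSet ψ lmax) = subPsiHypothesis ψ := by
  ext μ
  simp only [generatedHypothesis, constraintSet, mem_ofPred_eq, forall_mem_range]
  constructor
  · rintro ⟨h1, h2⟩
    refine mem_subPsiHypothesis_iff.2 ⟨h1, fun l hl => ?_⟩
    exact (integrable_and_integral_sub_one_nonpos_iff (hψ.measurable_expKernel _)
      (hψ.expKernel_nonneg _)).1 (h2 ⟨l, hψ.coe_mem_Icc hl⟩)
  · intro h
    have h1 := (mem_subPsiHypothesis_iff.1 h).1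
    exact ⟨h1, fun l => (integrable_and_integral_sub_one_nonpos_iff (hψ.measurable_expKernel l)
      (hψ.expKernel_nonneg l)).2 (hψ.lintegral_expKernel_le_one h l)⟩

theorem IsAdmissible.expKernel_le_one_of_nonpos (hψ : IsAdmissible ψ lmax) {l : ℝ}
    (hl : l ∈ effDom ψ) {x : ℝ} (hx : x ≤ 0) : expKernel ψ l x ≤ 1 := by
  rw [expKernel_coe hl, Real.exp_le_one_iff]
  have := mul_nonpos_of_nonneg_of_nonpos (hψ.nonneg_of_mem hl) hx
  have := hψ.toReal_nonneg l
  linarith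

/-- All probability measures on the nonpositive half-line are sub-`ψ`, and integrability under all
of them forces boundedness: otherwise put mass `2⁻⁽ⁿ⁺¹⁾` at a point where `f < -2ⁿ⁺¹`. -/
theorem IsAdmissible.exists_neg_le_of_nonpos (hψ : IsAdmissible ψ lmax) {f : SampleSpace ψ → ℝ}
    (hf : f ∈ integrableFunctions (constraintSet ψ lmax)) :
    ∃ B : ℝ, 0 ≤ B ∧ ∀ x : SampleSpace ψ, (x : ℝ) ≤ 0 → -B ≤ f x := by
  by_contra! hcon
  choose x hx hfx using fun n : ℕ => hcon (2 ^ (n + 1)) (by positivity)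
  set μ : Measure (SampleSpace ψ) :=
    Measure.sum fun n : ℕ => ((2⁻¹ : ℝ≥0∞) ^ (n + 1)) • Measure.dirac (x n) with hμ
  have hsum : ∑' n : ℕ, (2⁻¹ : ℝ≥0∞) ^ (n + 1) = 1 := by
    rw [ENNReal.tsum_geometric_add_one, ENNReal.one_sub_inv_two, inv_inv,
      ENNReal.inv_mul_cancel two_ne_zero ENNReal.ofNat_ne_top]
  have hlint : ∀ h : SampleSpace ψ → ℝ≥0∞,
      ∫⁻ y, h y ∂μ = ∑' n, (2⁻¹ : ℝ≥0∞) ^ (n + 1) * h (x n) := by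
    intro h
    simp [hμ, lintegral_smul_measure]
  have hP : μ ∈ subPsiHypothesis ψ := by
    refine mem_subPsiHypothesis_iff.2 ⟨⟨?_⟩, fun l hl => ?_⟩
    · simpa [hsum] using hlint 1
    · rw [hlint, ← hsum]
      refine ENNReal.tsum_le_tsum fun n => mul_le_of_le_one_right' ?_
      rw [ENNReal.ofReal_le_one]
      exact hψ.expKernel_le_one_of_nonpos hl (hx n)
  have hint := hf.2 μ (by rwa [hψ.generatedHypothesis_constraintSet])
  refine hint.2.ne ?_
  rw [hlint, ← top_le_iff, ← ENNReal.tsum_const_eq_top_of_ne_zero (α := ℕ) one_ne_zero]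
  refine ENNReal.tsum_le_tsum fun n => ?_
  have h1 : (2 : ℝ≥0∞) ^ (n + 1) ≤ ‖f (x n)‖ₑ := by
    rw [Real.enorm_eq_ofReal_abs, abs_of_neg ((hfx n).trans (by simp))]
    refine le_trans ?_ (ENNReal.ofReal_le_ofReal (lt_neg_of_lt_neg (hfx n)).le)
    rw [ENNReal.ofReal_pow (by norm_num)]
    simp
  calc (1 : ℝ≥0∞) = (2⁻¹) ^ (n + 1) * 2 ^ (n + 1) := by
        rw [← mul_pow, ENNReal.inv_mul_cancel two_ne_zero ENNReal.ofNat_ne_top, one_pow]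
    _ ≤ _ := by gcongr

end Hypothesis

/-! ### Finitely supported sub-`ψ` distributions -/

section Discrete

/-- The finitely supported measure with weights proportional to `w`, normalized to a probability
measure when `w ≠ 0`. -/
noncomputable def discreteMeasure {X : Type*} [MeasurableSpace X] (w : X →₀ ℝ≥0) : Measure X :=
  (w.sum fun _ c => (c : ℝ≥0∞))⁻¹ • w.sum fun x c => (c : ℝ≥0∞) • Measure.dirac x

theorem sum_weights_pos {X : Type*} {w : X →₀ ℝ≥0} (hw : w ≠ 0) : 0 < w.sum fun _ c => c := by
  refine Finset.sum_pos (fun x hx => pos_iff_ne_zero.2 (Finsupp.mem_support_iff.1 hx)) ?_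
  exact Finsupp.support_nonempty_iff.2 hw

theorem sum_weights_ennreal {X : Type*} (w : X →₀ ℝ≥0) :
    (w.sum fun _ c => (c : ℝ≥0∞)) = ((w.sum fun _ c => c : ℝ≥0) : ℝ≥0∞) := by
  simp [Finsupp.sum]

theorem sum_weights_real {X : Type*} (w : X →₀ ℝ≥0) :
    (w.sum fun _ c => (c : ℝ)) = ((w.sum fun _ c => c : ℝ≥0) : ℝ) := by
  simp [Finsupp.sum]

variable {X : Type*} [MeasurableSpace X] [MeasurableSingletonClass X]

theorem lintegral_discreteMeasure (w : X →₀ ℝ≥0) (h : X → ℝ≥0∞) :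
    ∫⁻ x, h x ∂(discreteMeasure w) =
      (w.sum fun _ c => (c : ℝ≥0∞))⁻¹ * w.sum fun x c => (c : ℝ≥0∞) * h x := by
  rw [discreteMeasure, lintegral_smul_measure, Finsupp.sum, Finsupp.sum,
    lintegral_finsetSum_measure]
  simp only [lintegral_smul_measure, lintegral_dirac, smul_eq_mul, Finsupp.sum]

theorem integral_discreteMeasure (w : X →₀ ℝ≥0) (f : X → ℝ) :
    ∫ x, f x ∂(discreteMeasure w) =
      (w.sum fun _ c => (c : ℝ))⁻¹ * w.sum fun x c => (c : ℝ) * f x := by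
  rw [discreteMeasure, integral_smul_measure, Finsupp.sum, Finsupp.sum, integral_finsetSum_measure]
  · simp [Finsupp.sum, ENNReal.toReal_sum, NNReal.smul_def]
  · exact fun x _ => (integrable_dirac enorm_lt_top).smul_measure ENNReal.coe_ne_top

variable {ψ : ℝ → EReal} {lmax : EReal}

theorem IsAdmissible.discreteMeasure_mem (hψ : IsAdmissible ψ lmax) {w : SampleSpace ψ →₀ ℝ≥0}
    (hw : w ≠ 0)
    (h : ∀ l ∈ effDom ψ, (w.sum fun x c => (c : ℝ) * (expKernel ψ l x - 1)) ≤ 0) :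
    discreteMeasure w ∈ subPsiHypothesis ψ := by
  have hT := sum_weights_pos hw
  have hle : ∀ h : SampleSpace ψ → ℝ≥0∞,
      (∫⁻ x, h x ∂(discreteMeasure w) ≤ 1 ↔
        (w.sum fun x c => (c : ℝ≥0∞) * h x) ≤ w.sum fun _ c => (c : ℝ≥0∞)) := by
    intro h
    rw [lintegral_discreteMeasure, mul_comm, ← div_eq_mul_inv, ENNReal.div_le_iff, one_mul]
    · rw [sum_weights_ennreal]; exact_mod_cast hT.ne'
    · rw [sum_weights_ennreal]; exact ENNReal.coe_ne_top
  refine mem_subPsiHypothesis_iff.2 ⟨⟨?_⟩, fun l hl => ?_⟩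
  · have := lintegral_discreteMeasure w 1
    simp only [Pi.one_apply, lintegral_one, mul_one] at this
    rw [this, sum_weights_ennreal, ENNReal.inv_mul_cancel (by exact_mod_cast hT.ne')
      ENNReal.coe_ne_top]
  · rw [hle]
    have h0 : ∀ x : SampleSpace ψ, 0 ≤ expKernel ψ l x :=
      hψ.expKernel_nonneg ⟨l, hψ.coe_mem_Icc hl⟩
    have h1 : (w.sum fun x c => (c : ℝ≥0∞) * ENNReal.ofReal (expKernel ψ l x)) =
        ENNReal.ofReal (w.sum fun x c => (c : ℝ) * expKernel ψ l x) := by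
      rw [Finsupp.sum, Finsupp.sum,
        ENNReal.ofReal_sum_of_nonneg (f := fun x => (w x : ℝ) * expKernel ψ l x)
          fun x _ => mul_nonneg (w x).2 (h0 x)]
      refine Finset.sum_congr rfl fun x _ => ?_
      rw [ENNReal.ofReal_mul (NNReal.coe_nonneg (w x)), ENNReal.ofReal_coe_nnreal]
    have h2 : (w.sum fun _ c => (c : ℝ≥0∞)) = ENNReal.ofReal (w.sum fun _ c => (c : ℝ)) := by
      rw [sum_weights_ennreal, sum_weights_real, ENNReal.ofReal_coe_nnreal]
    rw [h1, h2]
    refine ENNReal.ofReal_le_ofReal ?_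
    have h3 := h l hl
    simp only [Finsupp.sum, mul_sub, mul_one, Finset.sum_sub_distrib] at h3 ⊢
    linarith

/-- A violation `a` of the constraints by a finitely supported measure is repaired by any mass
`t > a` placed far enough to the left. The violation at `l` is at most `min a (C l)`, and mass `t`
at `-N` contributes at most `t (1 / (1 + l N) - 1)`; these balance for `N = C / (t - a)`,
uniformly in `l`. -/
theorem IsAdmissible.exists_add_single_mem (hψ : IsAdmissible ψ lmax)
    (w : SampleSpace ψ →₀ ℝ≥0) {a : ℝ} (ha : 0 ≤ a) {t : ℝ≥0} (hat : a < t)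
    (hw : ∀ l ∈ effDom ψ, (w.sum fun x c => (c : ℝ) * (expKernel ψ l x - 1)) ≤ a) :
    ∃ y : SampleSpace ψ, (y : ℝ) ≤ 0 ∧
      discreteMeasure (w + Finsupp.single y t) ∈ subPsiHypothesis ψ := by
  have hC0 : 0 ≤ w.sum fun x c => (c : ℝ) * Real.exp x :=
    Finset.sum_nonneg fun x _ => mul_nonneg (w x).2 (Real.exp_pos _).le
  set C : ℝ := (w.sum fun x c => (c : ℝ) * Real.exp x) + a with hC
  set N : ℝ := C / (t - a) with hN
  have hta : 0 < (t : ℝ) - a := sub_pos.2 hat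
  have hN0 : 0 ≤ N := div_nonneg (add_nonneg hC0 ha) hta.le
  have hy : -N ≤ 0 := neg_nonpos.2 hN0
  refine ⟨⟨-N, hψ.mem_sampleSpace_of_nonpos hy⟩, hy, hψ.discreteMeasure_mem ?_ fun l hl => ?_⟩
  · have ht0 : 0 < t := by exact_mod_cast ha.trans_lt hat
    intro h
    have := DFunLike.congr_fun h ⟨-N, hψ.mem_sampleSpace_of_nonpos hy⟩
    simp [ht0.ne'] at this
  · rw [Finsupp.sum_add_index' (by simp) (by intros; push_cast; ring),
      Finsupp.sum_single_index (by simp)]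
    have hl0 := hψ.nonneg_of_mem hl
    set u : ℝ := w.sum fun x c => (c : ℝ) * (expKernel ψ l x - 1) with hu
    have hua : u ≤ a := hw l hl
    have huC : u ≤ C * l := by
      rcases le_total l 1 with h1 | h1
      · have : u ≤ (w.sum fun x c => (c : ℝ) * Real.exp x) * l := by
          rw [hu, Finsupp.sum, Finsupp.sum, Finset.sum_mul]
          refine Finset.sum_le_sum fun x _ => ?_
          rw [mul_assoc]
          refine mul_le_mul_of_nonneg_left ?_ (w x).2
          have hconv := convexOn_exp.2 (mem_univ 0) (mem_univ (x : ℝ)) (sub_nonneg.2 h1) hl0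
            (by ring)
          simp only [smul_eq_mul, mul_zero, zero_add, Real.exp_zero, mul_one] at hconv
          have hψl := hψ.toReal_nonneg l
          have hexp : Real.exp (l * x - (ψ l).toReal) ≤ Real.exp (l * x) :=
            Real.exp_le_exp.2 (by linarith)
          rw [expKernel_coe hl]
          linarith
        rw [hC, add_mul]
        linarith [mul_nonneg ha hl0]
      · have : a * 1 ≤ a * l := mul_le_mul_of_nonneg_left h1 ha
        rw [hC, add_mul]
        linarith [mul_nonneg hC0 hl0]
    have hden : 0 < 1 + l * N := by positivity
    have hE : expKernel ψ l (-N) * (1 + l * N) ≤ 1 := by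
      have h1 : 1 + l * N ≤ Real.exp (l * N) := by linarith [Real.add_one_le_exp (l * N)]
      calc expKernel ψ l (-N) * (1 + l * N)
          ≤ Real.exp (l * -N - (ψ l).toReal) * Real.exp (l * N) := by
            rw [expKernel_coe hl]
            exact mul_le_mul_of_nonneg_left h1 (Real.exp_pos _).le
        _ = Real.exp (-(ψ l).toReal) := by rw [← Real.exp_add]; congr 1; ring
        _ ≤ 1 := Real.exp_le_one_iff.2 (neg_nonpos.2 (hψ.toReal_nonneg l))
    have hbal : ((t : ℝ) - a) * N = C := mul_div_cancel₀ _ hta.ne'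
    refine nonpos_of_mul_nonpos_left ?_ hden
    calc (u + t * (expKernel ψ l (-N) - 1)) * (1 + l * N)
        = u + u * (l * N) + t * (expKernel ψ l (-N) * (1 + l * N)) - t * (1 + l * N) := by ring
      _ ≤ C * l + a * (l * N) + t * 1 - t * (1 + l * N) := by gcongr
      _ = (C - (t - a) * N) * l := by ring
      _ = 0 := by rw [hbal]; ring

end Discrete

/-! ### Mixtures of the constraint functions -/

section Mixture

variable {ψ : ℝ → EReal} {lmax : EReal}

theorem IsAdmissible.measurable_uncurry_expKernel (hψ : IsAdmissible ψ lmax) :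
    Measurable (Function.uncurry fun (l : IndexSpace lmax) (x : SampleSpace ψ) =>
      expKernel ψ l x) :=
  measurable_uncurry_of_continuous_of_measurable hψ.continuous_expKernel hψ.measurable_expKernel

theorem IsAdmissible.integrable_expKernel (hψ : IsAdmissible ψ lmax)
    (π : Measure (IndexSpace lmax)) [IsFiniteMeasure π] (x : SampleSpace ψ) :
    Integrable (fun l : IndexSpace lmax => expKernel ψ l x) π :=
  (hψ.continuous_expKernel x).integrable_of_hasCompactSupport (HasCompactSupport.of_compactSpace _)

theorem IsAdmissible.integral_constraintFun (hψ : IsAdmissible ψ lmax)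
    (π : Measure (IndexSpace lmax)) [IsFiniteMeasure π] (x : SampleSpace ψ) :
    ∫ l, constraintFun ψ lmax l x ∂π = (∫ l : IndexSpace lmax, expKernel ψ l x ∂π) - π.real univ := by
  simp only [constraintFun]
  rw [integral_sub (hψ.integrable_expKernel π x) (integrable_const 1)]
  simp

theorem IsAdmissible.ofReal_integral_expKernel (hψ : IsAdmissible ψ lmax)
    (π : Measure (IndexSpace lmax)) [IsFiniteMeasure π] (x : SampleSpace ψ) :
    ENNReal.ofReal (∫ l : IndexSpace lmax, expKernel ψ l x ∂π) =
      ∫⁻ l : IndexSpace lmax, ENNReal.ofReal (expKernel ψ l x) ∂π :=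
  ofReal_integral_eq_lintegral_ofReal (hψ.integrable_expKernel π x)
    (Eventually.of_forall fun l => hψ.expKernel_nonneg l x)

theorem IsAdmissible.lintegral_lintegral_expKernel_le (hψ : IsAdmissible ψ lmax)
    (π : Measure (IndexSpace lmax)) [IsFiniteMeasure π] {μ : Measure (SampleSpace ψ)}
    (hμ : μ ∈ subPsiHypothesis ψ) :
    ∫⁻ x : SampleSpace ψ, ∫⁻ l : IndexSpace lmax, ENNReal.ofReal (expKernel ψ l x) ∂π ∂μ ≤
      π univ := by
  have := (mem_subPsiHypothesis_iff.1 hμ).1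
  rw [lintegral_lintegral_swap (f := fun (x : SampleSpace ψ) (l : IndexSpace lmax) =>
    ENNReal.ofReal (expKernel ψ l x))
    (hψ.measurable_uncurry_expKernel.comp measurable_swap).ennreal_ofReal.aemeasurable]
  calc _ ≤ ∫⁻ _ : IndexSpace lmax, 1 ∂π :=
        lintegral_mono fun l => hψ.lintegral_expKernel_le_one hμ l
    _ = π univ := by simp

/-- A function bounded by a mixture of the constraint functions has nonpositive expectation. -/
theorem IsAdmissible.integral_nonpos_of_le_mixture (hψ : IsAdmissible ψ lmax)
    {π : Measure (IndexSpace lmax)} [IsFiniteMeasure π] {f : SampleSpace ψ → ℝ}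
    (hf : ∀ x, f x ≤ ∫ l, constraintFun ψ lmax l x ∂π) {μ : Measure (SampleSpace ψ)}
    (hμ : μ ∈ subPsiHypothesis ψ) (hint : Integrable f μ) : ∫ x, f x ∂μ ≤ 0 := by
  have := (mem_subPsiHypothesis_iff.1 hμ).1
  have h1 : ∫⁻ x, ENNReal.ofReal (f x + π.real univ) ∂μ ≤ π univ := by
    refine le_trans (lintegral_mono fun x => ?_) (hψ.lintegral_lintegral_expKernel_le π hμ)
    rw [← hψ.ofReal_integral_expKernel]
    refine ENNReal.ofReal_le_ofReal ?_
    have := hf x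
    rw [hψ.integral_constraintFun] at this
    linarith
  have h2 : ∫ x, (f x + π.real univ) ∂μ ≤ π.real univ := by
    rw [integral_eq_lintegral_pos_part_sub_lintegral_neg_part
      (f := fun x => f x + π.real univ) (hint.add (integrable_const _))]
    exact (sub_le_self _ ENNReal.toReal_nonneg).trans
      (ENNReal.toReal_mono (measure_ne_top π univ) h1)
  rw [integral_add hint (integrable_const _)] at h2
  simpa using h2

/-- If `f ≥ -B` on the nonpositive half-line, the mixing measure can be taken of mass `B`: for
finite weights `w` violating the constraints by at most `a`, adding mass `t > a` far to the left
gives a sub-`ψ` distribution, so that `∑ w f ≤ B t`. -/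
theorem IsAdmissible.exists_mixture_of_integral_nonpos (hψ : IsAdmissible ψ lmax)
    {f : SampleSpace ψ → ℝ} (hf : ∀ μ ∈ subPsiHypothesis ψ, ∫ x, f x ∂μ ≤ 0) {B : ℝ}
    (hB0 : 0 ≤ B) (hB : ∀ x : SampleSpace ψ, (x : ℝ) ≤ 0 → -B ≤ f x) :
    ∃ π : Measure (IndexSpace lmax), IsFiniteMeasure π ∧ π univ = ENNReal.ofReal B ∧
      ∀ x, f x ≤ ∫ l, constraintFun ψ lmax l x ∂π := by
  have : Nonempty (IndexSpace lmax) := ⟨⟨0, left_mem_Icc.2 hψ.lmax_pos.le⟩⟩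
  refine exists_measure_forall_le_integral
    (fun x => ⟨fun l => constraintFun ψ lmax l x, (hψ.continuous_expKernel x).sub
      continuous_const⟩) f B fun w a hwa => ?_
  simp only [ContinuousMap.coe_mk, constraintFun] at hwa
  have ha : 0 ≤ a := by
    have h := hwa ⟨((0 : ℝ) : EReal), hψ.coe_mem_Icc hψ.zero_mem⟩
    simp only [expKernel_coe hψ.zero_mem, hψ.map_zero] at h
    simpa using h
  have key : ∀ t : ℝ≥0, a < t → (w.sum fun x c => (c : ℝ) * f x) ≤ B * t := by
    intro t hat
    obtain ⟨y, hy, hmem⟩ := hψ.exists_add_single_mem w ha hat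
      fun l hl => hwa ⟨l, hψ.coe_mem_Icc hl⟩
    have ht : (0 : ℝ) < t := ha.trans_lt hat
    have h1 := hf _ hmem
    rw [integral_discreteMeasure, sum_weights_real] at h1
    have hne : w + Finsupp.single y t ≠ 0 := fun h => by
      have := DFunLike.congr_fun h y
      simp at this
      exact ht.ne' (by simp [this.2])
    have hpos : (0 : ℝ) < ((w + Finsupp.single y t).sum fun _ c => c : ℝ≥0) :=
      NNReal.coe_pos.2 (sum_weights_pos hne)
    have h2 := nonpos_of_mul_nonpos_right h1 (inv_pos.2 hpos)
    rw [Finsupp.sum_add_index' (by simp) (by intros; push_cast; ring),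
      Finsupp.sum_single_index (by simp)] at h2
    have h3 : (t : ℝ) * -B ≤ t * f y := mul_le_mul_of_nonneg_left (hB y hy) ht.le
    linarith
  refine le_of_forall_pos_le_add fun ε hε => ?_
  have hε' : 0 < ε / (B + 1) := by positivity
  have h := key ⟨a + ε / (B + 1), by positivity⟩ (lt_add_of_pos_right a hε')
  refine h.trans ?_
  change B * (a + ε / (B + 1)) ≤ B * a + ε
  have h4 : B * (ε / (B + 1)) ≤ ε := by
    rw [mul_div_assoc', div_le_iff₀ (by positivity)]
    linarith
  linarith

/-- Every point of the sample space is charged by some sub-`ψ` distribution, so e-variables are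
finite everywhere. -/
theorem IsAdmissible.eVariable_ne_top (hψ : IsAdmissible ψ lmax) {h : SampleSpace ψ → ℝ≥0∞}
    (hh : ∀ μ ∈ subPsiHypothesis ψ, ∫⁻ x, h x ∂μ ≤ 1) (x : SampleSpace ψ) : h x ≠ ∞ := by
  obtain ⟨C, hC⟩ := hψ.exists_exponent_le x
  obtain ⟨t, ht⟩ : ∃ t : ℝ≥0, Real.exp C < t := ⟨(Real.exp C + 1).toNNReal, by
    rw [Real.coe_toNNReal _ (by positivity)]
    exact lt_add_one _⟩
  obtain ⟨y, -, hmem⟩ := hψ.exists_add_single_mem (Finsupp.single x 1) (Real.exp_pos C).le ht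
    fun l hl => by
      rw [Finsupp.sum_single_index (by simp), expKernel_coe hl]
      have := Real.exp_le_exp.2 (hC l hl)
      simp only [NNReal.coe_one, one_mul]
      linarith
  intro htop
  have h1 := hh _ hmem
  have h2 : ((Finsupp.single x 1 + Finsupp.single y t : SampleSpace ψ →₀ ℝ≥0).sum
      fun z c => (c : ℝ≥0∞) * h z) = ∞ := by
    rw [Finsupp.sum_add_index' (by simp) (by intros; push_cast; ring),
      Finsupp.sum_single_index (by simp), htop]
    simp
  rw [lintegral_discreteMeasure, sum_weights_ennreal, h2,
    ENNReal.mul_top (ENNReal.inv_ne_zero.2 ENNReal.coe_ne_top)] at h1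
  simp at h1

end Mixture

end EVar

theorem theorem4p1 (ψ : ℝ → EReal) (lmax : EReal) (hψ : EVar.IsAdmissible ψ lmax) :
    -- the constraint functions generate exactly the sub-ψ distributions
    EVar.generatedHypothesis (EVar.constraintSet ψ lmax) = EVar.subPsiHypothesis ψ ∧
    -- functions with nonpositive expectation
    (∀ f ∈ EVar.integrableFunctions (EVar.constraintSet ψ lmax),
      ((∀ μ ∈ EVar.subPsiHypothesis ψ, ∫ x, f x ∂μ ≤ 0) ↔
        ∃ π : Measure (EVar.IndexSpace lmax), IsFiniteMeasure π ∧
          ∀ x : EVar.SampleSpace ψ, f x ≤ ∫ l, EVar.constraintFun ψ lmax l x ∂π)) ∧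
    -- e-variables
    EVar.eVariables (EVar.subPsiHypothesis ψ) =
      {h : EVar.SampleSpace ψ → ℝ≥0∞ | Measurable h ∧
        ∃ π : Measure (EVar.IndexSpace lmax), IsProbabilityMeasure π ∧
          ∀ x : EVar.SampleSpace ψ,
            h x ≤ ∫⁻ l : EVar.IndexSpace lmax,
              ENNReal.ofReal (EVar.expKernel ψ (l : EReal) (x : ℝ)) ∂π} := by
  refine ⟨hψ.generatedHypothesis_constraintSet, fun f hf => ⟨fun hneg => ?_, ?_⟩, ?_⟩
  · obtain ⟨B, hB0, hB⟩ := hψ.exists_neg_le_of_nonpos hf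
    obtain ⟨π, hπ, -, hle⟩ := hψ.exists_mixture_of_integral_nonpos hneg hB0 hB
    exact ⟨π, hπ, hle⟩
  · rintro ⟨π, hπ, hle⟩ μ hμ
    exact hψ.integral_nonpos_of_le_mixture hle hμ
      (hf.2 μ (by rwa [hψ.generatedHypothesis_constraintSet]))
  · ext h
    constructor
    · rintro ⟨hmeas, hh⟩
      have htop := hψ.eVariable_ne_top hh
      have hneg : ∀ μ ∈ EVar.subPsiHypothesis ψ, ∫ x, ((h x).toReal - 1) ∂μ ≤ 0 := by
        intro μ hμ
        have := (EVar.mem_subPsiHypothesis_iff.1 hμ).1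
        refine ((EVar.integrable_and_integral_sub_one_nonpos_iff hmeas.ennreal_toReal
          fun x => (h x).toReal_nonneg).2 ?_).2
        simpa only [ENNReal.ofReal_toReal (htop _)] using hh μ hμ
      -- since `h - 1 ≥ -1`, the mixing measure for `h - 1` can be taken of mass one
      obtain ⟨π, hπ, hmass, hle⟩ := hψ.exists_mixture_of_integral_nonpos hneg zero_le_one
        fun x _ => by linarith [(h x).toReal_nonneg]
      have hprob : IsProbabilityMeasure π := ⟨by simpa using hmass⟩
      refine ⟨hmeas, π, hprob, fun x => ?_⟩
      have h1 := hle x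
      rw [hψ.integral_constraintFun, probReal_univ] at h1
      rw [← hψ.ofReal_integral_expKernel, ← ENNReal.ofReal_toReal (htop x)]
      exact ENNReal.ofReal_le_ofReal (by linarith)
    · rintro ⟨hmeas, π, hπ, hle⟩
      refine ⟨hmeas, fun μ hμ => (lintegral_mono hle).trans ?_⟩
      simpa using hψ.lintegral_lintegral_expKernel_le π hμ
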